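/- Let $H\in\mathbb F_2^{C\times V}$ be a parity-check matrix with finite sets $C$ of check nodes (CNs) and $V$ of variable nodes (VNs), let its Tanner graph have an edge $vc$ iff $H_{cv}=1$, and let the CNs be partitioned into ordered layers by a map $\mathrm{layer}:C\to\{1,\dots,m_b\}$ (for a QC-LDPC code: the row blocks of $H$). For $\mathcal S\subseteq V$ let $\Gamma(\mathcal S)$ be the set of CNs adjacent to $\mathcal S$, let the induced subgraph $G(\mathcal S)$ be the subgraph of the Tanner graph induced by $\mathcal S\cup\Gamma(\mathcal S)$, and call $c\in\Gamma(\mathcal S)$ missatisfied if it has even degree in $G(\mathcal S)$. $\mathcal S$ is a leafless elementary trapping set (LETS) if every $c\in\Gamma(\mathcal S)$ has degree $1$ or $2$ in $G(\mathcal S)$ and every $v\in\mathcal S$ is adjacent to at least two missatisfied CNs. A connected LETS is a simple cycle if every $v\in\mathcal S$ is adjacent to exactly two missatisfied CNs. The state variables of $\mathcal S$ are the $m_s$ edges $(v,c)$ with $v\in\mathcal S$ and $c$ missatisfied. The flooding transition matrix $\mathbf A\in\{0,1\}^{m_s\times m_s}$ has entry $1$ at row $(v,c)$ and column $(v',c')$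 iff $c'\ne c$, $v'\ne v$ and $v$ is adjacent to $c'$. Let $L_1<\dots<L_J$ be the layers that contain missatisfied CNs of $\mathcal S$. The matrix $\mathcal A_j$ has the rows of $\mathbf A$ at the state variables $(v,c)$ with $\mathrm{layer}(c)=L_j$ and the rows of the identity matrix elsewhere. Put $\tilde{\mathbf A}_{J\to1}=\mathcal A_J\mathcal A_{J-1}\cdots\mathcal A_1$. Let $n_z$ be the number of state variables $x=(v,c)$ such that every state variable $(w,d)$ whose row in $\mathbf A$ has a $1$ in column $x$ satisfies $\mathrm{layer}(d)>\mathrm{layer}(c)$. A Frobenius normal form (FNF) of a square matrix is a symmetric permutation of it to a block upper triangular matrix, each of whose diagonal blocks is either irreducible or a $1\times1$ zero matrix (a $1\times 1$ zero matrix is not counted as irreducible). **Theorem.** Let $\mathcal S$ be a LETS such that $G(\mathcal S)$ is connected and $\mathcal S$ is not a simple cycle. Then $\tilde{\mathbf A}_{J\to1}$ has an FNF, and every FNF of it has exactly one irreducible diagonal block $\tilde{\mathbf A}$. This block is the last one, it has size $m_s-n_z$, and the FNF has the form $$\begin{pmatrix}\mathbf 0_{n_z\times n_z}&\tilde{\mathbf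 A}'\\ \mathbf 0&\tilde{\mathbf A}\end{pmatrix}.$$ Moreover: (a) $\tilde{\mathbf A}_{J\to1}$ has a simple (algebraic multiplicity one) real eigenvalue $\tilde r>1$ equal to its spectral radius. (b) $\tilde{\mathbf A}$ has a left eigenvector $\tilde{\boldsymbol\omega}_1^T$ for $\tilde r$ with positive entries, and in the ordering of the FNF the non-negative vector $\tilde{\mathbf w}_1^T=(\mathbf 0_{1\times n_z}\mid\tilde{\boldsymbol\omega}_1^T)$ is, up to scaling, the unique left eigenvector of $\tilde{\mathbf A}_{J\to1}$ for $\tilde r$. (c) $\tilde{\mathbf A}$ has a right eigenvector $\tilde{\boldsymbol\nu}_1$ for $\tilde r$ with positive entries, and in the ordering of the FNF the non-negative vector $\tilde{\mathbf u}_1=\begin{pmatrix}\tilde r^{-1}\tilde{\mathbf A}'\tilde{\boldsymbol\nu}_1\\ \tilde{\boldsymbol\nu}_1\end{pmatrix}$ is, up to scaling, the unique right eigenvector of $\tilde{\mathbf A}_{J\to1}$ for $\tilde r$. -/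

import Mathlib

namespace LETS

section TannerGraph

variable {C V : Type*} [Fintype C]

/-- The Tanner graph of a binary code with parity-check matrix `H`: the variable nodes are the
columns, the check nodes are the rows, and `v` and `c` are adjacent iff `H c v = 1`. -/
def tannerGraph (H : Matrix C V (ZMod 2)) : SimpleGraph (V ⊕ C) where
  Adj x y := (∃ v c, x = Sum.inl v ∧ y = Sum.inr c ∧ H c v = 1) ∨
    (∃ v c, x = Sum.inr c ∧ y = Sum.inl v ∧ H c v = 1)
  symm := ⟨by
    rintro x y (⟨v, c, hx, hy, h⟩ | ⟨v, c, hx, hy, h⟩)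
    · exact Or.inr ⟨v, c, hy, hx, h⟩
    · exact Or.inl ⟨v, c, hy, hx, h⟩⟩
  loopless := ⟨by
    rintro x (⟨v, c, hx, hy, h⟩ | ⟨v, c, hx, hy, h⟩) <;> simp [hx] at hy⟩

/-- The degree of the check node `c` in the subgraph induced by the set `S` of variable nodes. -/
def checkDegree (H : Matrix C V (ZMod 2)) (S : Finset V) (c : C) : ℕ :=
  (S.filter fun v => H c v = 1).card

/-- `Γ(S)`: the check nodes adjacent to at least one variable node of `S`. -/
def checkNeighbors (H : Matrix C V (ZMod 2)) (S : Finset V) : Finset C :=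
  Finset.univ.filter fun c => 1 ≤ checkDegree H S c

/-- The missatisfied check nodes: the check nodes in `Γ(S)` of even degree in the induced
subgraph. -/
def missatisfied (H : Matrix C V (ZMod 2)) (S : Finset V) : Finset C :=
  (checkNeighbors H S).filter fun c => Even (checkDegree H S c)

/-- The subgraph of the Tanner graph induced by the variable nodes in `S` and the check nodes in
`Γ(S)`. -/
def inducedSubgraph (H : Matrix C V (ZMod 2)) (S : Finset V) :
    SimpleGraph ↥(Sum.inl '' (S : Set V) ∪ Sum.inr '' (checkNeighbors H S : Set C) :
      Set (V ⊕ C)) :=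
  (tannerGraph H).induce _

/-- The number of missatisfied check nodes to which the variable node `v` is connected. -/
def missatisfiedDegree (H : Matrix C V (ZMod 2)) (S : Finset V) (v : V) : ℕ :=
  ((missatisfied H S).filter fun c => H c v = 1).card

/-- `S` is a leafless elementary trapping set: all check nodes in the induced subgraph have degree
`1` or `2`, and each variable node of `S` is connected to at least two missatisfied check nodes. -/
structure IsLETS (H : Matrix C V (ZMod 2)) (S : Finset V) : Prop where
  elementary : ∀ c ∈ checkNeighbors H S, checkDegree H S c = 1 ∨ checkDegree H S c = 2
  leafless : ∀ v ∈ S, 2 ≤ missatisfiedDegree H S v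

/-- `S` is a simple cycle: a connected LETS in which every variable node is connected to exactly
two missatisfied check nodes. -/
structure IsSimpleCycle (H : Matrix C V (ZMod 2)) (S : Finset V) : Prop where
  isLETS : IsLETS H S
  connected : (inducedSubgraph H S).Connected
  degree_eq_two : ∀ v ∈ S, missatisfiedDegree H S v = 2

/-- The state variables: one for each edge `(v, c)` between a variable node `v ∈ S` and a
missatisfied check node `c`, standing for the message sent from `v` to `c`. -/
abbrev StateVar (H : Matrix C V (ZMod 2)) (S : Finset V) : Type _ :=
  {e : V × C // e.1 ∈ S ∧ e.2 ∈ missatisfied H S ∧ H e.2 e.1 = 1}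

end TannerGraph

section Transition

variable {C V : Type*} [Fintype C] [Fintype V] [DecidableEq C] [DecidableEq V]

/-- The transition matrix `A` of the flooding schedule. The message from `v` to `c` is a function
of the messages which `v` receives from its other missatisfied check nodes `c' ≠ c`, that is, of
the messages sent to such `c'` by the other neighbour `v' ≠ v` of `c'` in `S`. -/
def floodingMatrix (H : Matrix C V (ZMod 2)) (S : Finset V) :
    Matrix (StateVar H S) (StateVar H S) ℝ :=
  Matrix.of fun x y =>
    if y.1.2 ≠ x.1.2 ∧ y.1.1 ≠ x.1.1 ∧ H y.1.2 x.1.1 = 1 then 1 else 0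

variable {mb : ℕ}

/-- The transition matrix `𝒜_j` of layer `j`: the rows belonging to the state variables of layer
`j` are those of `A`, and all other rows are those of the identity matrix. -/
def layerMatrix (H : Matrix C V (ZMod 2)) (layer : C → Fin mb) (S : Finset V) (j : Fin mb) :
    Matrix (StateVar H S) (StateVar H S) ℝ :=
  Matrix.of fun x y =>
    if layer x.1.2 = j then floodingMatrix H S x y else (1 : Matrix _ _ ℝ) x y

/-- The set `{L_1, …, L_J}` of the layers containing missatisfied check nodes of `S`. -/
def layersOf (H : Matrix C V (ZMod 2)) (layer : C → Fin mb) (S : Finset V) : Finset (Fin mb) :=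
  (missatisfied H S).image layer

/-- The transition matrix `𝒜_J ⋯ 𝒜_1` of the layered decoder; layers with smaller index are
updated earlier. -/
noncomputable def layeredMatrix (H : Matrix C V (ZMod 2)) (layer : C → Fin mb) (S : Finset V) :
    Matrix (StateVar H S) (StateVar H S) ℝ :=
  (((layersOf H layer S).sort (· ≥ ·)).map (layerMatrix H layer S)).prod

open Classical in
/-- `n_z`: the number of state variables `x` such that all state variables which depend on `x` in
the flooding schedule are updated in strictly later layers than `x`. -/
noncomputable def nz (H : Matrix C V (ZMod 2)) (layer : C → Fin mb) (S : Finset V) : ℕ :=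
  (Finset.univ.filter fun x : StateVar H S =>
    ∀ y, floodingMatrix H S y x ≠ 0 → layer x.1.2 < layer y.1.2).card

end Transition

section NormalForm

variable {ι : Type*}

/-- `b : ι → Fin t` puts `M` into Frobenius normal form: listing the indices in the order of their
block number `b` is a symmetric permutation of `M` into a `t × t` block upper triangular array,
each of whose (nonempty) diagonal blocks is either irreducible or a `1 × 1` zero matrix. -/
structure IsFrobeniusNormalForm (M : Matrix ι ι ℝ) {t : ℕ} (b : ι → Fin t) : Prop where
  surjective : Function.Surjective b
  blockTriangular : M.BlockTriangular b
  diagonal : ∀ k, (M.toSquareBlock b k).IsIrreducible ∨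
    (Nat.card {x // b x = k} = 1 ∧ M.toSquareBlock b k = 0)

/-- The vector on `ι` that equals `ν` on the `k`-th block and `ν'` on its complement. -/
def stack {t : ℕ} (b : ι → Fin t) (k : Fin t) (ν' : {x // b x ≠ k} → ℝ) (ν : {x // b x = k} → ℝ) :
    ι → ℝ :=
  fun x => if h : b x = k then ν ⟨x, h⟩ else ν' ⟨x, h⟩

end NormalForm

end LETS

/-! Read a state variable (v, c) as the arc that leaves v through c for the other neighbour of c in
S. The flooding matrix then describes non-backtracking walks on a multigraph, which is connected,
leafless and not a cycle. On such a multigraph every arc reaches every arc (`reflTransGen_follows`):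
uniform non-backtracking transitions are doubly stochastic, so reachability is symmetric, and a
vertex of degree at least three lets a walk turn round. The layered product is one Gauss–Seidel
sweep: a row of it is a row of A into which the new rows of all strictly earlier layers have been
substituted. An arc of A into an earlier layer is thereby contracted into what follows it, and every
other arc survives. Hence column y is zero exactly when every arc into y comes from a later layer,
which is what `nz` counts. Every y with a nonzero column is reached from everywhere
(`IsSweep.transGen_of_reflTransGen`). Zero columns for the complement and reachability of the rest
determine every Frobenius normal form (`IsFrobeniusNormalForm.exists_block`). Perron–Frobenius for
the single irreducible block extends to the whole matrix (`exists_perron_of_irreducible_block`). The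
root exceeds 1 because all row sums are at least 1, and one inside the block is larger
(`IsSweep.exists_one_lt_rowSum`). -/

namespace Matrix

/-! ### Perron–Frobenius theory of irreducible matrices -/

variable {n : Type*} {A : Matrix n n ℝ}

/-- Quiver paths of positive length correspond to `TransGen`, not `ReflTransGen`; this is what
excludes the 1 × 1 zero matrix. -/
theorem isIrreducible_iff_transGen :
    A.IsIrreducible ↔
      (∀ i j, 0 ≤ A i j) ∧ ∀ i j, Relation.TransGen (fun i j => 0 < A i j) i j := by
  rw [isIrreducible_iff]
  refine and_congr_right fun _ => ?_
  let : Quiver n := toQuiver A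
  constructor
  · intro h i j
    obtain ⟨p, hp⟩ := h i j
    induction p with
    | nil => simp at hp
    | @cons b c q e ih =>
      rcases Nat.eq_zero_or_pos q.length with h0 | h0
      · obtain rfl := Quiver.Path.eq_of_length_zero q h0
        exact .single e.down
      · exact (ih h0).tail e.down
  · intro h i j
    have key : ∀ j, Relation.TransGen (fun i j => 0 < A i j) i j →
        ∃ p : Quiver.Path i j, 0 < p.length := by
      intro j hj
      induction hj with
      | single e => exact ⟨(Quiver.Path.nil).cons (PLift.up e), by simp⟩
      | tail _ e ih =>
        obtain ⟨p, _⟩ := ih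
        exact ⟨p.cons (PLift.up e), by simp⟩
    exact key j (h i j)

namespace IsIrreducible

variable [Fintype n]

/-- A sum of powers of A, one power for each entry that has to become positive. It turns a nonzero
non-negative vector into a positive one without disturbing relations between A and its scalars. -/
theorem exists_commute_pos [DecidableEq n] (h : A.IsIrreducible) :
    ∃ Q : Matrix n n ℝ, Commute A Q ∧ ∀ i j, 0 < Q i j := by
  choose k _ hk using (isIrreducible_iff_exists_pow_pos h.nonneg).1 h
  refine ⟨∑ i, ∑ j, A ^ k i j, ?_, fun i j => ?_⟩
  · exact Commute.sum_right _ _ _ fun i _ => Commute.sum_right _ _ _ fun j _ =>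
      (Commute.refl A).pow_right _
  · simp only [sum_apply]
    have hn : ∀ a b, 0 ≤ (A ^ k a b) i j := fun a b => pow_apply_nonneg h.nonneg _ _ _
    calc 0 < (A ^ k i j) i j := hk i j
      _ ≤ ∑ b, (A ^ k i b) i j :=
        Finset.single_le_sum (f := fun b => (A ^ k i b) i j) (fun b _ => hn i b)
          (Finset.mem_univ j)
      _ ≤ _ := Finset.single_le_sum (f := fun a => ∑ b, (A ^ k a b) i j)
          (fun a _ => Finset.sum_nonneg fun b _ => hn a b) (Finset.mem_univ i)

/-- A zero of x at a forces (A x) a ≤ 0, so x vanishes at every b with A a b > 0. Positivity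
therefore spreads backwards along arcs, whatever the sign of c. -/
theorem pos_of_mulVec_le (h : A.IsIrreducible) {x : n → ℝ} {c : ℝ} (hx : ∀ i, 0 ≤ x i)
    (hx0 : x ≠ 0) (hc : ∀ i, (A *ᵥ x) i ≤ c * x i) (i : n) : 0 < x i := by
  obtain ⟨j, hj⟩ : ∃ j, x j ≠ 0 := Function.ne_iff.1 hx0
  have hj : 0 < x j := lt_of_le_of_ne (hx j) hj.symm
  have step : ∀ a b, 0 < A a b → 0 < x b → 0 < x a := by
    intro a b hab hb
    refine lt_of_le_of_ne (hx a) fun h0 => ?_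
    have h1 := hc a
    rw [← h0, mul_zero] at h1
    have h2 : A a b * x b ≤ (A *ᵥ x) a :=
      Finset.single_le_sum (f := fun b => A a b * x b)
        (fun b _ => mul_nonneg (h.nonneg a b) (hx b)) (Finset.mem_univ b)
    nlinarith [mul_pos hab hb]
  have := (isIrreducible_iff_transGen.1 h).2 i j
  induction this using Relation.TransGen.head_induction_on with
  | single e => exact step _ _ e hj
  | head e _ ih => exact step _ _ e ih

theorem eq_smul_of_mulVec_eq [Nonempty n] (h : A.IsIrreducible) {ν u : n → ℝ} {r : ℝ}
    (hν : ∀ i, 0 < ν i) (hAν : A *ᵥ ν = r • ν) (hu : A *ᵥ u = r • u) : ∃ s : ℝ, u = s • ν := by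
  -- The largest s with u - s • ν ≥ 0. The difference vanishes at i₀, so it cannot be a nonzero
  -- non-negative eigenvector.
  obtain ⟨i₀, hi₀⟩ := Finite.exists_min fun i => u i / ν i
  set s := u i₀ / ν i₀
  refine ⟨s, ?_⟩
  by_contra hne
  have hx0 : u - s • ν ≠ 0 := sub_ne_zero.2 hne
  have := h.pos_of_mulVec_le (c := r) (x := u - s • ν) (fun i => ?_) hx0 (fun i => ?_) i₀
  · simp [s, (hν i₀).ne'] at this
  · have := (le_div_iff₀ (hν i)).1 (hi₀ i)
    simpa using this
  · rw [mulVec_sub, mulVec_smul, hAν, hu]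
    simp only [Pi.sub_apply, Pi.smul_apply, smul_eq_mul]
    exact le_of_eq (by ring)

/-- The Perron vector, found by maximizing the Collatz–Wielandt function on the simplex. -/
theorem exists_pos_mulVec_eq [Nonempty n] (h : A.IsIrreducible) :
    ∃ (r : ℝ) (ν : n → ℝ), (∀ i, 0 < ν i) ∧ A *ᵥ ν = r • ν := by
  classical
  set c : ℝ := ∑ i, ∑ j, A i j
  have hc0 : 0 ≤ c := Finset.sum_nonneg fun i _ => Finset.sum_nonneg fun j _ => h.nonneg i j
  have bound : ∀ x ∈ stdSimplex ℝ n, ∀ ρ, (∀ i, ρ * x i ≤ (A *ᵥ x) i) → ρ ≤ c := by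
    intro x hx ρ hρ
    calc ρ = ∑ i, ρ * x i := by rw [← Finset.mul_sum, hx.2, mul_one]
      _ ≤ ∑ i, (A *ᵥ x) i := Finset.sum_le_sum fun i _ => hρ i
      _ ≤ c := Finset.sum_le_sum fun i _ => Finset.sum_le_sum fun j _ => by
        have : x j ≤ 1 := hx.2 ▸ Finset.single_le_sum (fun k _ => hx.1 k) (Finset.mem_univ j)
        exact mul_le_of_le_one_right (h.nonneg i j) this
  -- Carrying ρ as a coordinate makes the maximum that of a projection on a compact set, so no
  -- continuity of the Collatz–Wielandt quotient is needed.
  let K : Set ((n → ℝ) × ℝ) :=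
    (stdSimplex ℝ n ×ˢ Set.Icc 0 c) ∩ {p | ∀ i, p.2 * p.1 i ≤ (A *ᵥ p.1) i}
  have hK : IsCompact K := by
    refine ((isCompact_stdSimplex ℝ n).prod isCompact_Icc).inter_right ?_
    rw [Set.ofPred_forall]
    refine isClosed_iInter fun i => isClosed_le (by fun_prop) ?_
    simp only [mulVec, dotProduct]
    fun_prop
  have hKne : K.Nonempty := by
    obtain ⟨i⟩ := ‹Nonempty n›
    refine ⟨(Pi.single i 1, 0), ⟨single_mem_stdSimplex ℝ i, le_rfl, hc0⟩, fun j => ?_⟩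
    rw [zero_mul]
    exact Finset.sum_nonneg fun k _ =>
      mul_nonneg (h.nonneg j k) ((single_mem_stdSimplex ℝ i).1 k)
  obtain ⟨⟨x, ρ⟩, ⟨⟨hx, hρ⟩, hle⟩, hmax⟩ := hK.exists_isMaxOn hKne continuous_snd.continuousOn
  simp only [Set.mem_ofPred_eq] at hx hρ hle
  have hx0 : x ≠ 0 := by
    rintro rfl
    simpa using hx.2
  have heq : A *ᵥ x = ρ • x := by
    by_contra hne
    -- If A x ≥ ρ x is not an equality, applying Q makes it strict in every coordinate, and ρ can be
    -- raised by the smallest relative slack ε.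
    obtain ⟨Q, hAQ, hQ⟩ := h.exists_commute_pos
    have hQpos : ∀ y : n → ℝ, (∀ i, 0 ≤ y i) → y ≠ 0 → ∀ i, 0 < (Q *ᵥ y) i := by
      intro y hy hy0 i
      obtain ⟨j, hj⟩ := Function.ne_iff.1 hy0
      exact Finset.sum_pos' (fun k _ => mul_nonneg (hQ i k).le (hy k))
        ⟨j, Finset.mem_univ j, mul_pos (hQ i j) (lt_of_le_of_ne (hy j) (Ne.symm hj))⟩
    have hx' := hQpos x hx.1 hx0
    have hy' := hQpos (A *ᵥ x - ρ • x) (fun i => by simpa using hle i) (sub_ne_zero.2 hne)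
    set x' := Q *ᵥ x
    have hAx' : A *ᵥ x' - ρ • x' = Q *ᵥ (A *ᵥ x - ρ • x) := by
      rw [mulVec_sub, mulVec_smul, mulVec_mulVec, mulVec_mulVec, hAQ.eq]
    rw [← hAx'] at hy'
    obtain ⟨i₀, hi₀⟩ := Finite.exists_min fun i => (A *ᵥ x' - ρ • x') i / x' i
    set ε := (A *ᵥ x' - ρ • x') i₀ / x' i₀
    have hε : 0 < ε := div_pos (hy' i₀) (hx' i₀)
    have hs : 0 < ∑ i, x' i := Finset.sum_pos (fun i _ => hx' i) Finset.univ_nonempty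
    set s := ∑ i, x' i
    have hmem : s⁻¹ • x' ∈ stdSimplex ℝ n := by
      refine ⟨fun i => ?_, ?_⟩
      · exact mul_nonneg (inv_nonneg.2 hs.le) (hx' i).le
      · simp only [Pi.smul_apply, smul_eq_mul, ← Finset.mul_sum]
        exact inv_mul_cancel₀ hs.ne'
    have hle' : ∀ i, (ρ + ε) * (s⁻¹ • x') i ≤ (A *ᵥ (s⁻¹ • x')) i := by
      intro i
      have h1 := (le_div_iff₀ (hx' i)).1 (hi₀ i)
      simp only [Pi.sub_apply, Pi.smul_apply, smul_eq_mul] at h1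
      rw [mulVec_smul]
      simp only [Pi.smul_apply, smul_eq_mul]
      have : (ρ + ε) * x' i ≤ (A *ᵥ x') i := by linarith
      calc (ρ + ε) * (s⁻¹ * x' i) = s⁻¹ * ((ρ + ε) * x' i) := by ring
        _ ≤ _ := mul_le_mul_of_nonneg_left this (inv_nonneg.2 hs.le)
    have := hmax (a := (s⁻¹ • x', ρ + ε))
      ⟨⟨hmem, add_nonneg hρ.1 hε.le, bound _ hmem _ hle'⟩, hle'⟩
    simp only [Set.mem_ofPred_eq] at this
    linarith
  exact ⟨ρ, x, h.pos_of_mulVec_le (c := ρ) hx.1 hx0 fun i => by simp [heq], heq⟩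

/-- The Perron root of an irreducible matrix has positive right and left eigenvectors. -/
theorem exists_pos_eigenvectors [Nonempty n] (h : A.IsIrreducible) :
    ∃ (r : ℝ) (ν ω : n → ℝ), (∀ i, 0 < ν i) ∧ (∀ i, 0 < ω i) ∧
      A *ᵥ ν = r • ν ∧ ω ᵥ* A = r • ω := by
  obtain ⟨r, ν, hν, hAν⟩ := h.exists_pos_mulVec_eq
  obtain ⟨r', ω, hω, hAω⟩ := h.transpose.exists_pos_mulVec_eq
  rw [mulVec_transpose] at hAω
  -- Evaluating ω A ν in both ways identifies the right and left eigenvalues.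
  have hpos : 0 < ω ⬝ᵥ ν :=
    Finset.sum_pos (fun i _ => mul_pos (hω i) (hν i)) Finset.univ_nonempty
  have := dotProduct_mulVec ω A ν
  rw [hAν, hAω, dotProduct_smul, smul_dotProduct, smul_eq_mul, smul_eq_mul] at this
  obtain rfl := mul_right_cancel₀ hpos.ne' this
  exact ⟨r, ν, ω, hν, hω, hAν, hAω⟩

end IsIrreducible

/-- An eigenvalue whose eigenspace is spanned by `u` is simple if it has a left eigenvector that
is not orthogonal to `u`. -/
theorem rootMultiplicity_charpoly_eq_one [Fintype n] [DecidableEq n] {r : ℝ} {u w : n → ℝ}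
    (hu : A *ᵥ u = r • u) (hw : w ᵥ* A = r • w) (hwu : w ⬝ᵥ u ≠ 0)
    (huniq : ∀ v, A *ᵥ v = r • v → ∃ s : ℝ, v = s • u) :
    A.charpoly.rootMultiplicity r = 1 := by
  have hu0 : u ≠ 0 := by
    rintro rfl
    simp at hwu
  rw [← charpoly_toLin' A, ← LinearMap.finrank_maxGenEigenspace_eq]
  have hker : ∀ v, (A.toLin' - r • (1 : Module.End ℝ (n → ℝ))) v = A *ᵥ v - r • v := by
    intro v
    simp [toLin'_apply]
  have hspan : Module.End.maxGenEigenspace A.toLin' r = Submodule.span ℝ {u} := by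
    apply le_antisymm
    · intro v hv
      rw [Module.End.mem_maxGenEigenspace] at hv
      obtain ⟨k, hk⟩ := hv
      rw [Submodule.mem_span_singleton]
      induction k generalizing v with
      | zero =>
        refine ⟨0, ?_⟩
        simpa using hk.symm
      | succ k ih =>
        rw [pow_succ, Module.End.mul_apply] at hk
        obtain ⟨s, hs⟩ := ih hk
        rw [hker] at hs
        -- The left eigenvector annihilates the range of A - r but not u, so a Jordan chain above u
        -- is impossible.
        have h1 : w ⬝ᵥ (A *ᵥ v - r • v) = 0 := by
          rw [dotProduct_sub, dotProduct_mulVec, hw, smul_dotProduct, dotProduct_smul, sub_self]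
        rw [← hs, dotProduct_smul, smul_eq_mul] at h1
        have hs0 : s = 0 := (mul_eq_zero.1 h1).resolve_right hwu
        rw [hs0, zero_smul] at hs
        obtain ⟨t, ht⟩ := huniq v (sub_eq_zero.1 hs.symm)
        exact ⟨t, ht.symm⟩
    · rw [Submodule.span_singleton_le_iff_mem, Module.End.mem_maxGenEigenspace]
      exact ⟨1, by rw [pow_one, hker, hu, sub_self]⟩
  rw [hspan, finrank_span_singleton hu0]

/-- A non-negative matrix whose zero columns cover the complement of the support of a
non-negative left eigenvector `w` has its spectral radius at the eigenvalue of `w`. -/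
theorem spectralRadius_eq_of_vecMul [Fintype n] [DecidableEq n] {r : ℝ} {u w : n → ℝ}
    (hA : ∀ i j, 0 ≤ A i j) (hr : 0 ≤ r) (hw0 : ∀ i, 0 ≤ w i)
    (hcol : ∀ j, w j = 0 → ∀ i, A i j = 0) (hw : w ᵥ* A = r • w)
    (hu0 : u ≠ 0) (hu : A *ᵥ u = r • u) :
    spectralRadius ℂ (A.map (algebraMap ℝ ℂ)) = ENNReal.ofReal r := by
  have hmem : ∀ μ : ℂ, μ ∈ spectrum ℂ (A.map (algebraMap ℝ ℂ)) ↔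
      ∃ z : n → ℂ, z ≠ 0 ∧ A.map (algebraMap ℝ ℂ) *ᵥ z = μ • z := by
    intro μ
    rw [← spectrum_toLin', ← Module.End.hasEigenvalue_iff_mem_spectrum]
    constructor
    · intro h
      obtain ⟨z, hz⟩ := h.exists_hasEigenvector
      exact ⟨z, hz.2, by simpa using hz.apply_eq_smul⟩
    · rintro ⟨z, hz0, hz⟩
      exact Module.End.hasEigenvalue_of_hasEigenvector (x := z)
        ⟨Module.End.mem_eigenspace_iff.2 (by simpa using hz), hz0⟩
  apply le_antisymm
  · refine iSup₂_le fun μ hμ => ?_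
    obtain ⟨z, hz0, hz⟩ := (hmem μ).1 hμ
    rw [← ENNReal.ofReal_coe_nnreal, coe_nnnorm]
    refine ENNReal.ofReal_le_ofReal ?_
    have h1 : ∀ i, ‖μ‖ * ‖z i‖ ≤ (A *ᵥ fun j => ‖z j‖) i := by
      intro i
      rw [← norm_mul, ← smul_eq_mul, ← Pi.smul_apply, ← hz]
      refine (norm_sum_le _ _).trans (Finset.sum_le_sum fun j _ => ?_)
      beta_reduce
      rw [norm_mul, map_apply, norm_algebraMap', Real.norm_of_nonneg (hA i j)]
    -- Pairing |μ| |z| ≤ A |z| with w gives |μ| ≤ r unless the pairing is zero. In that case z lives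
    -- on zero columns, so A z = 0 and μ = 0.
    have h2 : ‖μ‖ * ∑ i, w i * ‖z i‖ ≤ r * ∑ i, w i * ‖z i‖ := by
      calc ‖μ‖ * ∑ i, w i * ‖z i‖ = ∑ i, w i * (‖μ‖ * ‖z i‖) := by
            rw [Finset.mul_sum]
            exact Finset.sum_congr rfl fun i _ => by ring
        _ ≤ w ⬝ᵥ (A *ᵥ fun j => ‖z j‖) :=
            Finset.sum_le_sum fun i _ => mul_le_mul_of_nonneg_left (h1 i) (hw0 i)
        _ = r * ∑ i, w i * ‖z i‖ := by
            rw [dotProduct_mulVec, hw, smul_dotProduct, smul_eq_mul, dotProduct]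
    have hnn : ∀ i, 0 ≤ w i * ‖z i‖ := fun i => mul_nonneg (hw0 i) (norm_nonneg _)
    rcases (Finset.sum_nonneg fun i (_ : i ∈ Finset.univ) => hnn i).eq_or_lt with h0 | h0
    · have hz' : ∀ i, w i * ‖z i‖ = 0 := fun i =>
        (Finset.sum_eq_zero_iff_of_nonneg fun i _ => hnn i).1 h0.symm i (Finset.mem_univ i)
      have hAz : A.map (algebraMap ℝ ℂ) *ᵥ z = 0 := by
        funext i
        refine Finset.sum_eq_zero fun j _ => ?_
        rcases mul_eq_zero.1 (hz' j) with hj | hj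
        · simp [hcol j hj i]
        · rw [norm_eq_zero.1 hj, mul_zero]
      rw [hAz] at hz
      rw [(smul_eq_zero.1 hz.symm).resolve_right hz0, norm_zero]
      exact hr
    · exact le_of_mul_le_mul_right h2 h0
  · have : (r : ℂ) ∈ spectrum ℂ (A.map (algebraMap ℝ ℂ)) := by
      refine (hmem _).2 ⟨fun i => (u i : ℂ), ?_, ?_⟩
      · obtain ⟨i, hi⟩ := Function.ne_iff.1 hu0
        exact Function.ne_iff.2 ⟨i, by simpa using hi⟩
      · funext i
        have := congrFun hu i
        simp only [mulVec, dotProduct, Pi.smul_apply, smul_eq_mul, map_apply,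
          Complex.coe_algebraMap] at this ⊢
        exact_mod_cast this
    refine le_trans (le_of_eq ?_) (le_iSup₂ (α := ENNReal) (r : ℂ) this)
    rw [← ENNReal.ofReal_coe_nnreal, coe_nnnorm, Complex.norm_real, Real.norm_of_nonneg hr]

end Matrix

/-! ### Matrices whose nonzero columns lie in one block -/

namespace Matrix

section SumsOverABlock

variable {n : Type*} [Fintype n] {M : Matrix n n ℝ} {t : ℕ} {b : n → Fin t} {k : Fin t}

theorem sum_eq_sum_block {f : n → ℝ} (hf : ∀ x, b x ≠ k → f x = 0) :
    ∑ x, f x = ∑ x : {x // b x = k}, f x := by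
  rw [← Fintype.sum_subtype_add_sum_subtype (fun x => b x = k) f, add_eq_left]
  exact Finset.sum_eq_zero fun x _ => hf x x.2

theorem vecMul_toSquareBlock {w : n → ℝ} (hw : ∀ x, b x ≠ k → w x = 0) (y : {x // b x = k}) :
    ((fun x : {x // b x = k} => w x) ᵥ* M.toSquareBlock b k) y = (w ᵥ* M) y :=
  (sum_eq_sum_block (f := fun x => w x * M x y) fun x hx => by rw [hw x hx, zero_mul]).symm

theorem mulVec_toSquareBlock (hcol : ∀ x y, b y ≠ k → M x y = 0) (u : n → ℝ)
    (x : {x // b x = k}) :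
    (M.toSquareBlock b k *ᵥ fun y : {x // b x = k} => u y) x = (M *ᵥ u) x :=
  (sum_eq_sum_block (f := fun y => M x y * u y) fun y hy => by
    rw [hcol x y hy, zero_mul]).symm

theorem mulVec_toBlock (hcol : ∀ x y, b y ≠ k → M x y = 0) (u : n → ℝ) (x : {x // b x ≠ k}) :
    (M.toBlock (fun x => b x ≠ k) (fun x => b x = k) *ᵥ fun y : {x // b x = k} => u y) x =
      (M *ᵥ u) x :=
  (sum_eq_sum_block (f := fun y => M x y * u y) fun y hy => by
    rw [hcol x y hy, zero_mul]).symm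

end SumsOverABlock

end Matrix

namespace LETS

open Matrix

variable {ι : Type*}

theorem stack_of_eq {t : ℕ} {b : ι → Fin t} {k : Fin t} {ν' : {x // b x ≠ k} → ℝ}
    {ν : {x // b x = k} → ℝ} (x : {x // b x = k}) : stack b k ν' ν x = ν x :=
  dif_pos x.2

theorem stack_of_ne {t : ℕ} {b : ι → Fin t} {k : Fin t} {ν' : {x // b x ≠ k} → ℝ}
    {ν : {x // b x = k} → ℝ} (x : {x // b x ≠ k}) : stack b k ν' ν x = ν' x :=
  dif_neg x.2

theorem funext_block {t : ℕ} (b : ι → Fin t) (k : Fin t) {f g : ι → ℝ}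
    (h : ∀ x : {x // b x = k}, f x = g x) (h' : ∀ x : {x // b x ≠ k}, f x = g x) : f = g := by
  funext x
  by_cases hx : b x = k
  · exact h ⟨x, hx⟩
  · exact h' ⟨x, hx⟩

/-- Perron–Frobenius theory of a non-negative matrix `[0 M'; 0 M₁]` with an irreducible block `M₁`
whose row sums are at least `1` and not all equal to `1`. -/
theorem exists_perron_of_irreducible_block [Fintype ι] [DecidableEq ι]
    {M : Matrix ι ι ℝ} (hM : ∀ x y, 0 ≤ M x y) {t : ℕ} {b : ι → Fin t} {k : Fin t} (hcol : ∀ x y, b y ≠ k → M x y = 0)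
    (hirr : (M.toSquareBlock b k).IsIrreducible) (hrow : ∀ x, 1 ≤ ∑ y, M x y)
    (hrow' : ∃ x, b x = k ∧ 1 < ∑ y, M x y) :
    ∃ r : ℝ, 1 < r ∧ M.charpoly.rootMultiplicity r = 1 ∧
      spectralRadius ℂ (M.map (algebraMap ℝ ℂ)) = ENNReal.ofReal r ∧
      (∃ ω : {x // b x = k} → ℝ, (∀ x, 0 < ω x) ∧
        ω ᵥ* M.toSquareBlock b k = r • ω ∧
        (∀ x, 0 ≤ stack b k 0 ω x) ∧
        stack b k 0 ω ᵥ* M = r • stack b k 0 ω ∧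
        ∀ w : ι → ℝ, w ᵥ* M = r • w → ∃ s : ℝ, w = s • stack b k 0 ω) ∧
      (∃ ν : {x // b x = k} → ℝ, (∀ x, 0 < ν x) ∧
        M.toSquareBlock b k *ᵥ ν = r • ν ∧
        (∀ x, 0 ≤ stack b k
          (r⁻¹ • M.toBlock (fun x => b x ≠ k) (fun x => b x = k) *ᵥ ν) ν x) ∧
        M *ᵥ stack b k (r⁻¹ • M.toBlock (fun x => b x ≠ k) (fun x => b x = k) *ᵥ ν) ν =
          r • stack b k (r⁻¹ • M.toBlock (fun x => b x ≠ k) (fun x => b x = k) *ᵥ ν) ν ∧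
        ∀ u : ι → ℝ, M *ᵥ u = r • u → ∃ s : ℝ, u = s •
          stack b k (r⁻¹ • M.toBlock (fun x => b x ≠ k) (fun x => b x = k) *ᵥ ν) ν) := by
  obtain ⟨x₀, hx₀, hx₀'⟩ := hrow'
  have : Nonempty {x // b x = k} := ⟨⟨x₀, hx₀⟩⟩
  obtain ⟨r, ν, ω, hν, hω, hBν, hBω⟩ := hirr.exists_pos_eigenvectors
  set B := M.toSquareBlock b k
  -- Summing the entries of ω B = r ω weights the row sums of B by ω. These are row sums of M,
  -- because the other columns vanish.
  have hr1 : 1 < r := by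
    have h1 : ∑ x, ω x < r * ∑ x, ω x := by
      calc ∑ x, ω x < ∑ x, ω x * ∑ y, B x y := by
            have hB : ∀ x, ∑ y, B x y = ∑ y, M x y := fun x =>
              (sum_eq_sum_block (f := fun y => M x y) fun y hy => hcol x y hy).symm
            refine Finset.sum_lt_sum (fun x _ => ?_) ⟨⟨x₀, hx₀⟩, Finset.mem_univ _, ?_⟩
            · exact le_mul_of_one_le_right (hω x).le (hB x ▸ hrow x)
            · exact lt_mul_of_one_lt_right (hω _) (hB _ ▸ hx₀')
        _ = ∑ y, (ω ᵥ* B) y := by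
            simp_rw [Finset.mul_sum]
            exact Finset.sum_comm
        _ = r * ∑ x, ω x := by
            rw [hBω, Finset.mul_sum]
            rfl
    have h2 : 0 < ∑ x, ω x := Finset.sum_pos (fun x _ => hω x) Finset.univ_nonempty
    by_contra! h3
    nlinarith
  have hr0 : r ≠ 0 := by positivity
  set w := stack b k 0 ω
  set u := stack b k (r⁻¹ • M.toBlock (fun x => b x ≠ k) (fun x => b x = k) *ᵥ ν) ν
  have hwk : (fun x : {x // b x = k} => w x) = ω := funext stack_of_eq
  have huk : (fun x : {x // b x = k} => u x) = ν := funext stack_of_eq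
  have hw0 : ∀ x, b x ≠ k → w x = 0 := fun x hx => stack_of_ne ⟨x, hx⟩
  have hwn : ∀ x, 0 ≤ w x := by
    intro x
    by_cases hx : b x = k
    · exact (hω ⟨x, hx⟩).le.trans_eq (stack_of_eq (ν := ω) ⟨x, hx⟩).symm
    · exact (hw0 x hx).ge
  have hun : ∀ x, 0 ≤ u x := by
    intro x
    by_cases hx : b x = k
    · exact (hν ⟨x, hx⟩).le.trans_eq (stack_of_eq (ν := ν) ⟨x, hx⟩).symm
    · rw [show u x = _ from stack_of_ne ⟨x, hx⟩]
      exact mul_nonneg (by positivity)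
        (Finset.sum_nonneg fun y _ => mul_nonneg (hM _ _) (hν y).le)
  have hcolw : ∀ (w : ι → ℝ) y, b y ≠ k → (w ᵥ* M) y = 0 := fun w y hy =>
    Finset.sum_eq_zero fun x _ => by
      beta_reduce
      rw [hcol x y hy, mul_zero]
  have hwM : w ᵥ* M = r • w := by
    refine funext_block b k (fun y => ?_) fun y => ?_
    · rw [← vecMul_toSquareBlock hw0, hwk, hBω, ← hwk]
      rfl
    · rw [hcolw w y y.2, Pi.smul_apply, hw0 y y.2, smul_zero]
  have hMu : M *ᵥ u = r • u := by
    refine funext_block b k (fun x => ?_) fun x => ?_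
    · rw [← mulVec_toSquareBlock hcol, huk, hBν, ← huk]
      rfl
    · rw [← mulVec_toBlock hcol, huk, Pi.smul_apply, show u x = _ from stack_of_ne x,
        Pi.smul_apply, smul_smul, mul_inv_cancel₀ hr0, one_smul]
  have hwuniq : ∀ v : ι → ℝ, v ᵥ* M = r • v → ∃ s : ℝ, v = s • w := by
    intro v hv
    -- Zero columns and r ≠ 0 force a left eigenvector to vanish off the block.
    have hv0 : ∀ x, b x ≠ k → v x = 0 := fun x hx => by
      have := congrFun hv x
      rw [hcolw v x hx] at this
      exact (mul_eq_zero.1 this.symm).resolve_left hr0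
    obtain ⟨s, hs⟩ := hirr.transpose.eq_smul_of_mulVec_eq (r := r) hω
      (by rw [mulVec_transpose, hBω]) (u := fun x => v x) (by
        rw [mulVec_transpose]
        funext y
        rw [vecMul_toSquareBlock hv0, hv]
        rfl)
    refine ⟨s, funext_block b k (fun x => ?_) fun x => ?_⟩
    · rw [Pi.smul_apply, show w x = _ from congrFun hwk x]
      exact congrFun hs x
    · rw [Pi.smul_apply, hv0 x x.2, hw0 x x.2, smul_zero]
  have huuniq : ∀ v : ι → ℝ, M *ᵥ v = r • v → ∃ s : ℝ, v = s • u := by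
    intro v hv
    obtain ⟨s, hs⟩ := hirr.eq_smul_of_mulVec_eq (r := r) hν hBν (u := fun x => v x) (by
      funext y
      rw [mulVec_toSquareBlock hcol, hv]
      rfl)
    refine ⟨s, funext_block b k (fun x => ?_) fun x => ?_⟩
    · rw [Pi.smul_apply, show u x = _ from congrFun huk x]
      exact congrFun hs x
    -- Off the block, r times the entry is determined by the entries on the block, so
    -- proportionality there carries over.
    · have h1 := mulVec_toBlock hcol v x
      have h2 := mulVec_toBlock hcol u x
      rw [hs, mulVec_smul, hv] at h1
      rw [huk, hMu] at h2
      rw [Pi.smul_apply, h2, Pi.smul_apply, smul_comm] at h1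
      exact (smul_right_injective ℝ hr0 h1).symm
  have hwpos : ∀ x, b x = k → 0 < w x := fun x hx =>
    (hω ⟨x, hx⟩).trans_eq (stack_of_eq (ν := ω) ⟨x, hx⟩).symm
  have hupos : 0 < u x₀ := (hν ⟨x₀, hx₀⟩).trans_eq (stack_of_eq (ν := ν) ⟨x₀, hx₀⟩).symm
  have hwu : 0 < w ⬝ᵥ u :=
    Finset.sum_pos' (fun x _ => mul_nonneg (hwn x) (hun x))
      ⟨x₀, Finset.mem_univ _, mul_pos (hwpos x₀ hx₀) hupos⟩
  refine ⟨r, hr1, rootMultiplicity_charpoly_eq_one hMu hwM hwu.ne' huuniq,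
    spectralRadius_eq_of_vecMul hM (by positivity) hwn (fun y hy x => ?_) hwM
      (Function.ne_iff.2 ⟨x₀, hupos.ne'⟩) hMu,
    ⟨ω, hω, hBω, hwn, hwM, hwuniq⟩, ⟨ν, hν, hBν, hun, hMu, huuniq⟩⟩
  exact hcol x y fun hyk => (hwpos y hyk).ne' hy

end LETS

/-! ### Gauss–Seidel sweeps -/

namespace LETS

open Matrix Relation

section GaussSeidel

variable {ι α : Type*} [Fintype ι] [DecidableEq ι] [LinearOrder α]

/-- `M` performs one sweep of the iteration `A`, in which the entries are updated in the order of
their layers `ℓ`, and all entries of a layer at the same time. -/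
def IsSweep (A M : Matrix ι ι ℝ) (ℓ : ι → α) : Prop :=
  ∀ x y, M x y = ∑ z, A x z * if ℓ z < ℓ x then M z y else (1 : Matrix ι ι ℝ) z y

/-- The matrix with the rows of `A` in layer `j` and the rows of the identity elsewhere. -/
def updateLayer (A : Matrix ι ι ℝ) (ℓ : ι → α) (j : α) : Matrix ι ι ℝ :=
  Matrix.of fun x y => if ℓ x = j then A x y else (1 : Matrix ι ι ℝ) x y

theorem updateLayer_mul_of_ne {A P : Matrix ι ι ℝ} {ℓ : ι → α} {j : α} {x : ι} (hx : ℓ x ≠ j)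
    (y : ι) : (updateLayer A ℓ j * P) x y = P x y := by
  have : ∀ z, updateLayer A ℓ j x z = (1 : Matrix ι ι ℝ) x z := fun z => if_neg hx
  rw [mul_apply]
  simp_rw [this]
  rw [← mul_apply, one_mul]

theorem updateLayer_mul_of_eq {A P : Matrix ι ι ℝ} {ℓ : ι → α} {j : α} {x : ι} (hx : ℓ x = j)
    (y : ι) : (updateLayer A ℓ j * P) x y = ∑ z, A x z * P z y := by
  have : ∀ z, updateLayer A ℓ j x z = A x z := fun z => if_pos hx
  rw [mul_apply]
  simp_rw [this]

/-- The list decreases, so its head is the layer updated last. At that moment the rows of lower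
layers are final, and those of the head's own and higher layers are still identity rows. -/
theorem prod_updateLayer_apply (A : Matrix ι ι ℝ) (ℓ : ι → α) {l : List α}
    (hl : l.Pairwise (· > ·)) (x y : ι) :
    (l.map (updateLayer A ℓ)).prod x y =
      if ℓ x ∈ l then
        ∑ z, A x z * if ℓ z < ℓ x then (l.map (updateLayer A ℓ)).prod z y
          else (1 : Matrix ι ι ℝ) z y
      else (1 : Matrix ι ι ℝ) x y := by
  induction l generalizing x with
  | nil => simp
  | cons a l ih =>
    obtain ⟨ha, hl⟩ := List.pairwise_cons.1 hl
    rw [List.map_cons, List.prod_cons]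
    set P := (l.map (updateLayer A ℓ)).prod
    by_cases hx : ℓ x = a
    · rw [updateLayer_mul_of_eq hx, if_pos (by simp [hx])]
      refine Finset.sum_congr rfl fun z _ => ?_
      congr 1
      split_ifs with hz
      · rw [updateLayer_mul_of_ne (hx ▸ hz.ne)]
      · rw [ih hl, if_neg fun hzl => hz (hx ▸ ha _ hzl)]
    · rw [updateLayer_mul_of_ne hx, ih hl]
      simp only [List.mem_cons, hx, false_or]
      split_ifs with hxl
      · refine Finset.sum_congr rfl fun z _ => ?_
        congr 1
        split_ifs with hz
        · rw [updateLayer_mul_of_ne (hz.trans (ha _ hxl)).ne]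
        · rfl
      · rfl

theorem isSweep_prod_updateLayer (A : Matrix ι ι ℝ) (ℓ : ι → α) {l : List α}
    (hl : l.Pairwise (· > ·)) (hmem : ∀ x, ℓ x ∈ l) :
    IsSweep A (l.map (updateLayer A ℓ)).prod ℓ := fun x y => by
  conv_lhs => rw [prod_updateLayer_apply A ℓ hl, if_pos (hmem x)]

namespace IsSweep

variable {A M : Matrix ι ι ℝ} {ℓ : ι → α}

theorem rowSum_eq (h : IsSweep A M ℓ) (x : ι) :
    ∑ y, M x y = ∑ z, A x z * if ℓ z < ℓ x then ∑ y, M z y else 1 := by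
  simp_rw [h x]
  rw [Finset.sum_comm]
  refine Finset.sum_congr rfl fun z _ => ?_
  rw [← Finset.mul_sum]
  congr 1
  split_ifs
  · rfl
  · simp [one_apply]

theorem apply_nonneg [WellFoundedLT α] (h : IsSweep A M ℓ) (hA : ∀ x y, 0 ≤ A x y) (x y : ι) :
    0 ≤ M x y := by
  induction x using (InvImage.wf ℓ wellFounded_lt).induction with
  | _ x ih =>
    rw [h x y]
    refine Finset.sum_nonneg fun z _ => mul_nonneg (hA x z) ?_
    split_ifs with hz
    · exact ih z hz
    · rw [one_apply]
      split_ifs <;> norm_num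

variable [WellFoundedLT α]

theorem term_le (h : IsSweep A M ℓ) (hA : ∀ x y, 0 ≤ A x y)
    (x y z : ι) :
    A x z * (if ℓ z < ℓ x then M z y else (1 : Matrix ι ι ℝ) z y) ≤ M x y := by
  rw [h x y]
  refine Finset.single_le_sum
    (f := fun z => A x z * if ℓ z < ℓ x then M z y else (1 : Matrix ι ι ℝ) z y)
    (fun z _ => mul_nonneg (hA x z) ?_) (Finset.mem_univ z)
  split_ifs
  · exact h.apply_nonneg hA z y
  · rw [one_apply]
    split_ifs <;> norm_num

theorem apply_pos_of_lt (h : IsSweep A M ℓ) (hA : ∀ x y, 0 ≤ A x y)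
    {x y z : ι} (hxz : A x z ≠ 0) (hlt : ℓ z < ℓ x) (hz : 0 < M z y) :
    0 < M x y := by
  refine lt_of_lt_of_le ?_ (h.term_le hA x y z)
  rw [if_pos hlt]
  exact mul_pos ((hA x z).lt_of_ne hxz.symm) hz

theorem apply_pos_of_le (h : IsSweep A M ℓ) (hA : ∀ x y, 0 ≤ A x y)
    {x y : ι} (hxy : A x y ≠ 0) (hle : ¬ ℓ y < ℓ x) : 0 < M x y := by
  refine lt_of_lt_of_le ?_ (h.term_le hA x y y)
  rw [if_neg hle, one_apply_eq, mul_one]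
  exact (hA x y).lt_of_ne hxy.symm

/-- Along a walk of A, an arc into an earlier layer merges with the next arc of M, and any other arc
is itself an arc of M. The condition on the last arc ensures that no merge is left without a
successor. -/
theorem transGen_of_reflTransGen (h : IsSweep A M ℓ) (hA : ∀ x y, 0 ≤ A x y)
    {x y z : ι} (hxz : ReflTransGen (fun i j => A i j ≠ 0) x z)
    (hzy : A z y ≠ 0) (hle : ¬ ℓ y < ℓ z) : TransGen (fun i j => 0 < M i j) x y := by
  induction hxz using ReflTransGen.head_induction_on with
  | refl => exact .single (h.apply_pos_of_le hA hzy hle)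
  | @head x x' hxx' _ ih =>
    by_cases hlt : ℓ x' < ℓ x
    · obtain ⟨w, hw, hwy⟩ := TransGen.head'_iff.1 ih
      exact TransGen.head' (h.apply_pos_of_lt hA hxx' hlt hw) hwy
    · exact ih.head (h.apply_pos_of_le hA hxx' hlt)

theorem one_le_rowSum (h : IsSweep A M ℓ) (hA : ∀ x y, 0 ≤ A x y)
    (hrow : ∀ x, 1 ≤ ∑ y, A x y) (x : ι) : 1 ≤ ∑ y, M x y := by
  induction x using (InvImage.wf ℓ wellFounded_lt).induction with
  | _ x ih =>
    rw [h.rowSum_eq]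
    refine (hrow x).trans (Finset.sum_le_sum fun z _ => le_mul_of_one_le_right (hA x z) ?_)
    split_ifs with hz
    · exact ih z hz
    · exact le_rfl

theorem rowSum_le (h : IsSweep A M ℓ) (hA : ∀ x y, 0 ≤ A x y)
    (hrow : ∀ x, 1 ≤ ∑ y, A x y) (x : ι) : ∑ y, A x y ≤ ∑ y, M x y := by
  rw [h.rowSum_eq]
  refine Finset.sum_le_sum fun z _ => le_mul_of_one_le_right (hA x z) ?_
  split_ifs with hz
  · exact h.one_le_rowSum hA hrow z
  · exact le_rfl

/-- Substituting row z into row x with a coefficient at least 1 passes on its whole row sum. -/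
theorem rowSum_le_of_lt (h : IsSweep A M ℓ) (hA : ∀ x y, 0 ≤ A x y)
    (hrow : ∀ x, 1 ≤ ∑ y, A x y) {x z : ι} (hxz : 1 ≤ A x z)
    (hlt : ℓ z < ℓ x) : ∑ y, M z y ≤ ∑ y, M x y := by
  have hpos : ∀ x, 0 ≤ ∑ y, M x y := fun x => zero_le_one.trans (h.one_le_rowSum hA hrow x)
  rw [h.rowSum_eq x]
  calc ∑ y, M z y ≤ A x z * ∑ y, M z y := le_mul_of_one_le_left (hpos z) hxz
    _ = A x z * if ℓ z < ℓ x then ∑ y, M z y else 1 := by rw [if_pos hlt]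
    _ ≤ _ := Finset.single_le_sum
      (f := fun z => A x z * if ℓ z < ℓ x then ∑ y, M z y else 1)
      (fun z _ => mul_nonneg (hA x z) (by
        split_ifs
        · exact hpos z
        · exact zero_le_one)) (Finset.mem_univ z)

/-- The large row must lie in the irreducible block. One in the highest possible layer does: if all
its predecessors were in later layers, they would inherit a row sum above 1. -/
theorem exists_one_lt_rowSum (h : IsSweep A M ℓ) (hA : ∀ x y, 0 ≤ A x y)
    (hA1 : ∀ x y, A x y ≠ 0 → 1 ≤ A x y)
    (hrow : ∀ x, 1 ≤ ∑ y, A x y) (hrow' : ∃ x, 1 < ∑ y, A x y) (hcol : ∀ y, ∃ x, A x y ≠ 0) :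
    ∃ x, (∃ z, A z x ≠ 0 ∧ ¬ ℓ x < ℓ z) ∧ 1 < ∑ y, M x y := by
  obtain ⟨x₀, hx₀⟩ := hrow'
  obtain ⟨x, hx, hmax⟩ := (Finset.univ.filter fun x => 1 < ∑ y, M x y).exists_max_image ℓ
    ⟨x₀, by simpa using hx₀.trans_le (h.rowSum_le hA hrow x₀)⟩
  simp only [Finset.mem_filter, Finset.mem_univ, true_and] at hx hmax
  refine ⟨x, ?_, hx⟩
  obtain ⟨z, hz⟩ := hcol x
  refine ⟨z, hz, fun hlt => ?_⟩
  exact (hmax z (hx.trans_le (h.rowSum_le_of_lt hA hrow (hA1 z x hz) hlt))).not_gt hlt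

end IsSweep

/-- The columns of a sweep which vanish. -/
theorem IsSweep.apply_eq_zero [WellFoundedLT α] {A M : Matrix ι ι ℝ} {ℓ : ι → α}
    (h : IsSweep A M ℓ) {y : ι} (hy : ∀ z, A z y ≠ 0 → ℓ y < ℓ z) (x : ι) : M x y = 0 := by
  induction x using (InvImage.wf ℓ wellFounded_lt).induction with
  | _ x ih =>
    rw [h x y]
    refine Finset.sum_eq_zero fun z _ => ?_
    split_ifs with hz
    · rw [ih z hz, mul_zero]
    · rcases eq_or_ne z y with rfl | hzy
      · rw [not_imp_comm.1 (hy x) hz, zero_mul]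
      · rw [one_apply_ne hzy, mul_zero]

end GaussSeidel

/-! ### Frobenius normal forms -/

section NormalForm

variable {ι : Type*} {M : Matrix ι ι ℝ} {t : ℕ} {b : ι → Fin t}

theorem le_of_transGen (hb : M.BlockTriangular b) {x y : ι}
    (hxy : TransGen (fun i j => 0 < M i j) x y) : b x ≤ b y := by
  induction hxy with
  | single h => exact not_lt.1 fun hlt => h.ne' (hb hlt)
  | tail _ h ih => exact ih.trans (not_lt.1 fun hlt => h.ne' (hb hlt))

/-- Every vertex that a walk enters has a nonzero column, so a walk starting in p never leaves p. -/
theorem transGen_subtype {p : ι → Prop} (hp : ∀ x y, 0 < M x y → p y) {x : {x // p x}} {y : ι}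
    (hxy : TransGen (fun i j => 0 < M i j) x y) (hy : p y) :
    TransGen (fun i j : {x // p x} => 0 < M i j) x ⟨y, hy⟩ := by
  induction hxy with
  | single h => exact .single h
  | @tail a _ _ h ih =>
    obtain ⟨w, _, hw⟩ := TransGen.tail'_iff.1 ‹TransGen _ _ a›
    exact (ih (hp _ _ hw)).tail h

/-- If the nonzero columns of a non-negative matrix `M` are those in `p`, and all of them can be
reached from every index, then `p` is one block of every Frobenius normal form of `M`. -/
theorem IsFrobeniusNormalForm.exists_block {p : ι → Prop} (hcol : ∀ x y, ¬ p y → M x y = 0)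
    (hreach : ∀ x y, p y → TransGen (fun i j => 0 < M i j) x y) (hp : ∃ y, p y)
    (hb : IsFrobeniusNormalForm M b) :
    ∃ k, (∀ x, b x = k ↔ p x) ∧ (M.toSquareBlock b k).IsIrreducible ∧
      (∀ k', (M.toSquareBlock b k').IsIrreducible → k' = k) ∧ ∀ k', k' ≤ k := by
  obtain ⟨y, hy⟩ := hp
  have hmem : ∀ k, (M.toSquareBlock b k).IsIrreducible → ∀ x, b x = k → p x := by
    intro k hk x hx
    by_contra hpx
    -- In an irreducible block every index is entered by some arc, which a zero column rules out.
    obtain ⟨w, _, hw⟩ := TransGen.tail'_iff.1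
      ((isIrreducible_iff_transGen.1 hk).2 ⟨x, hx⟩ ⟨x, hx⟩)
    exact hw.ne' (hcol _ _ hpx)
  have hpk : ∀ x, p x → b x = b y := fun x hx =>
    (le_of_transGen hb.blockTriangular (hreach x y hy)).antisymm
      (le_of_transGen hb.blockTriangular (hreach y x hx))
  have hirr : (M.toSquareBlock b (b y)).IsIrreducible := by
    refine (hb.diagonal (b y)).resolve_right fun ⟨_, h0⟩ => ?_
    -- A closed walk through y cannot change its block number, so its first arc is a nonzero entry
    -- of the diagonal block.
    obtain ⟨w, hyw, hwy⟩ := TransGen.head'_iff.1 (hreach y y hy)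
    have h1 : b y ≤ b w := not_lt.1 fun hlt => hyw.ne' (hb.blockTriangular hlt)
    have h2 : b w ≤ b y := by
      rcases reflTransGen_iff_eq_or_transGen.1 hwy with h | h
      · exact h ▸ le_rfl
      · exact le_of_transGen hb.blockTriangular h
    have := congrFun (congrFun h0 ⟨y, rfl⟩) ⟨w, h2.antisymm h1⟩
    exact hyw.ne' this
  refine ⟨b y, fun x => ⟨hmem _ hirr x, hpk x⟩, hirr, fun k' hk' => ?_, fun k' => ?_⟩
  · obtain ⟨x, hx⟩ := hb.surjective k'
    rw [← hx, hpk x (hmem k' hk' x hx)]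
  · obtain ⟨x, hx⟩ := hb.surjective k'
    exact hx ▸ le_of_transGen hb.blockTriangular (hreach x y hy)

/-- Indices outside p have zero columns, so they can stand first as singleton blocks in any order,
with p as the last block. -/
theorem exists_isFrobeniusNormalForm [Fintype ι] {p : ι → Prop} (hM : ∀ x y, 0 ≤ M x y)
    (hcol : ∀ x y, ¬ p y → M x y = 0)
    (hreach : ∀ x y, p y → TransGen (fun i j => 0 < M i j) x y) (hp : ∃ y, p y) :
    ∃ (t : ℕ) (b : ι → Fin t), IsFrobeniusNormalForm M b := by
  classical
  obtain ⟨y₀, hy₀⟩ := hp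
  let e : {x // ¬ p x} ≃ Fin (Fintype.card {x // ¬ p x}) := Fintype.equivFin _
  let b : ι → Fin (Fintype.card {x // ¬ p x} + 1) := fun x =>
    if h : p x then Fin.last _ else (e ⟨x, h⟩).castSucc
  have hbp : ∀ x, p x → b x = Fin.last _ := fun x hx => dif_pos hx
  have hbn : ∀ x (hx : ¬ p x), b x = (e ⟨x, hx⟩).castSucc := fun x hx => dif_neg hx
  have hbl : ∀ x, b x = Fin.last _ → p x := by
    intro x hx
    by_contra h
    exact (Fin.castSucc_lt_last _).ne ((hbn x h).symm.trans hx)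
  refine ⟨_, b, ⟨fun k => ?_, fun x y hxy => ?_, fun k => ?_⟩⟩
  · induction k using Fin.lastCases with
    | last => exact ⟨y₀, hbp _ hy₀⟩
    | cast k => exact ⟨(e.symm k).1, by rw [hbn _ (e.symm k).2]; simp⟩
  · refine hcol x y fun hy => ?_
    rw [hbp y hy] at hxy
    exact (Fin.le_last _).not_gt hxy
  · induction k using Fin.lastCases with
    | last =>
      refine .inl (isIrreducible_iff_transGen.2 ⟨fun x y => hM x y, fun x y => ?_⟩)
      exact transGen_subtype (p := fun x => b x = Fin.last _)
        (fun x y h => hbp y (not_imp_comm.1 (hcol x y) h.ne')) (hreach x y (hbl y y.2)) y.2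
    | cast k =>
      have huniq : ∀ x, b x = k.castSucc → x = (e.symm k).1 := by
        intro x hx
        have hpx : ¬ p x := fun h => (Fin.castSucc_lt_last k).ne (hx.symm.trans (hbp x h))
        rw [hbn x hpx] at hx
        rw [← Fin.castSucc_injective _ hx, Equiv.symm_apply_apply]
      refine .inr ⟨Nat.card_eq_one_iff_exists.2 ⟨⟨(e.symm k).1, ?_⟩, fun x => ?_⟩, ?_⟩
      · rw [hbn _ (e.symm k).2]
        simp
      · exact Subtype.ext (huniq x x.2)
      · ext x y
        exact hcol x y (huniq y y.2 ▸ (e.symm k).2)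

end NormalForm

end LETS

/-! ### Non-backtracking walks -/

namespace LETS

open Matrix Relation

section NonBacktracking

variable {E W : Type*} {rev : E → E} {τ : E → W}

/-- The arc `y` of a multigraph with reversal `rev` and initial vertices `τ` can be followed by
the arc `x` in a non-backtracking walk. -/
def Follows (rev : E → E) (τ : E → W) (x y : E) : Prop :=
  τ x = τ (rev y) ∧ x ≠ rev y

/-- A set of arcs closed under passing to arcs that can precede is closed under passing to arcs
that can follow, because the transition matrix of the non-backtracking random walk is doubly
stochastic. -/
theorem mem_of_follows [Fintype E] (hrev : Function.Involutive rev)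
    (hdeg : ∀ x, ∃ z, z ≠ x ∧ τ z = τ x) {T : Set E}
    (hT : ∀ x ∈ T, ∀ y, Follows rev τ x y → y ∈ T) {x y : E} (hxy : Follows rev τ x y)
    (hy : y ∈ T) : x ∈ T := by
  classical
  let d : E → ℕ := fun x => (Finset.univ.filter fun z => τ x = τ z ∧ x ≠ z).card
  -- Uniform weights on the other arcs at the same vertex. Since d depends only on the vertex, f is
  -- symmetric, so its column sums are 1 as well.
  let f : E → E → ℝ := fun x z => if τ x = τ z ∧ x ≠ z then (d x : ℝ)⁻¹ else 0
  have hd : ∀ x, 0 < (d x : ℝ) := fun x => by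
    obtain ⟨z, hz, hz'⟩ := hdeg x
    exact_mod_cast Finset.card_pos.2 ⟨z, by simp [hz.symm, hz'.symm]⟩
  have hf0 : ∀ x z, 0 ≤ f x z := fun x z => by
    simp only [f]
    split_ifs
    · exact inv_nonneg.2 (hd x).le
    · exact le_rfl
  have hf1 : ∀ x, ∑ z, f x z = 1 := fun x => by
    simp only [f, ← Finset.sum_filter, Finset.sum_const, nsmul_eq_mul]
    exact mul_inv_cancel₀ (hd x).ne'
  have hdτ : ∀ x z, τ x = τ z → d x = d z := fun x z hxz => by
    have hcard : ∀ x, d x = ((Finset.univ.filter fun z => τ x = τ z).erase x).card := fun x => by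
      refine congrArg Finset.card (Finset.ext fun z => ?_)
      simp [and_comm, eq_comm]
    rw [hcard, hcard, Finset.card_erase_of_mem (by simp), Finset.card_erase_of_mem (by simp), hxz]
  have hfs : ∀ x z, f x z = f z x := fun x z => by
    simp only [f]
    by_cases h : τ x = τ z ∧ x ≠ z
    · rw [if_pos h, if_pos ⟨h.1.symm, h.2.symm⟩, hdτ x z h.1]
    · rw [if_neg h, if_neg fun h' => h ⟨h'.1.symm, h'.2.symm⟩]
  -- The probability of stepping from x back into T. It is 1 on T and its total is the size of T, so
  -- it vanishes off T.
  let g : E → ℝ := fun x => ∑ z, if rev z ∈ T then f x z else 0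
  have hg0 : ∀ x, 0 ≤ g x := fun x => Finset.sum_nonneg fun z _ => by
    split_ifs
    · exact hf0 x z
    · exact le_rfl
  have hgT : ∀ x ∈ T, g x = 1 := fun x hx => by
    rw [← hf1 x]
    refine Finset.sum_congr rfl fun z _ => ?_
    split_ifs with hz
    · rfl
    · refine (if_neg fun h => hz (hT x hx _ ?_)).symm
      rwa [Follows, hrev z]
  have hgsum : ∑ x, g x = ∑ x, if x ∈ T then 1 else 0 := by
    calc ∑ x, g x = ∑ z, if rev z ∈ T then (1 : ℝ) else 0 := by
          rw [Finset.sum_comm]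
          refine Finset.sum_congr rfl fun z _ => ?_
          split_ifs
          · simp_rw [fun x => hfs x z]
            exact hf1 z
          · exact Finset.sum_const_zero
      _ = _ := Equiv.sum_comp (hrev.toPerm rev) fun z => if z ∈ T then (1 : ℝ) else 0
  by_contra hx
  have hle : ∀ x, (if x ∈ T then (1 : ℝ) else 0) ≤ g x := fun x => by
    split_ifs with h
    · exact (hgT x h).ge
    · exact hg0 x
  have hgx := (Finset.sum_eq_sum_iff_of_le fun x _ => hle x).1 hgsum.symm x (Finset.mem_univ x)
  rw [if_neg hx] at hgx
  have h1 : f x (rev y) ≤ g x := by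
    have := Finset.single_le_sum (f := fun z => if rev z ∈ T then f x z else 0)
      (fun z _ => by
        split_ifs
        · exact hf0 x z
        · exact le_rfl) (Finset.mem_univ (rev y))
    simpa only [hrev y, if_pos hy] using this
  have h2 : f x (rev y) = (d x : ℝ)⁻¹ := if_pos hxy
  have := inv_pos.2 (hd x)
  linarith

/-- The non-backtracking walks of a finite connected multigraph without leaves, which is not a
cycle, lead from every arc to every arc. -/
theorem reflTransGen_follows [Finite E] (hrev : Function.Involutive rev)
    (hdeg : ∀ x, ∃ z, z ≠ x ∧ τ z = τ x)
    (hdeg₃ : ∃ x y z, x ≠ y ∧ x ≠ z ∧ y ≠ z ∧ τ x = τ y ∧ τ x = τ z)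
    (hconn : ∀ G : W → Prop, (∃ x, G (τ x)) → (∀ x, G (τ x) → G (τ (rev x))) → ∀ x, G (τ x))
    (x y : E) : ReflTransGen (Follows rev τ) x y := by
  have := Fintype.ofFinite E
  have symm : ∀ {x y}, ReflTransGen (Follows rev τ) x y → ReflTransGen (Follows rev τ) y x := by
    intro x y hxy
    induction hxy using ReflTransGen.head_induction_on with
    | refl => exact .refl
    | @head x x' hxx' _ ih =>
      exact mem_of_follows hrev hdeg (T := {z | ReflTransGen (Follows rev τ) y z})
        (fun x hx z hz => ReflTransGen.tail hx hz) hxx' ih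
  have turn : ∀ {x z}, τ x = τ z → x ≠ z → ReflTransGen (Follows rev τ) x (rev z) :=
    fun hxz hne => .single ⟨by rwa [hrev], by rwa [hrev]⟩
  obtain ⟨e, a, b, hea, heb, hab, hτa, hτb⟩ := hdeg₃
  -- Both orientations are needed: from x and its reversal, turning at τ x connects any other arc
  -- there, in both directions, to e.
  let G : W → Prop := fun v => ∀ x, τ x = v →
    ReflTransGen (Follows rev τ) x e ∧ ReflTransGen (Follows rev τ) (rev x) e
  have spread : ∀ x, ReflTransGen (Follows rev τ) x e → ReflTransGen (Follows rev τ) (rev x) e →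
      G (τ x) := by
    intro x hx hx' z hz
    rcases eq_or_ne z x with rfl | hne
    · exact ⟨hx, hx'⟩
    · exact ⟨(turn hz hne).trans hx', (symm (turn hz.symm hne.symm)).trans hx⟩
  -- Three arcs at one vertex allow a reversal, through the chain rev e, b, rev a, e.
  have he : ReflTransGen (Follows rev τ) (rev e) e :=
    ((symm (turn hτb.symm heb.symm)).trans (turn (hτb.symm.trans hτa) hab.symm)).trans
      (symm (turn hτa hea))
  have hG := hconn G ⟨e, spread e .refl he⟩ fun x hx =>
    spread (rev x) (hx x rfl).2 (by rw [hrev]; exact (hx x rfl).1)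
  exact ((hG x x rfl).1).trans (symm (hG y y rfl).1)

end NonBacktracking

/-! ### State variables as arcs -/

section StateVariables

variable {C V : Type*} [Fintype C] {H : Matrix C V (ZMod 2)} {S : Finset V}

theorem IsLETS.checkDegree_eq_two (hS : IsLETS H S) {c : C} (hc : c ∈ missatisfied H S) :
    checkDegree H S c = 2 := by
  obtain ⟨hc, heven⟩ := Finset.mem_filter.1 hc
  refine (hS.elementary c hc).resolve_left fun h => ?_
  rw [h] at heven
  exact Nat.not_even_one heven

theorem mem_missatisfied_of_ne (hS : IsLETS H S) {c : C} {v v' : V} (hv : v ∈ S) (hv' : v' ∈ S)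
    (hvv' : v ≠ v') (hcv : H c v = 1) (hcv' : H c v' = 1) : c ∈ missatisfied H S := by
  have h2 : 1 < checkDegree H S c := Finset.one_lt_card.2
    ⟨v, Finset.mem_filter.2 ⟨hv, hcv⟩, v', Finset.mem_filter.2 ⟨hv', hcv'⟩, hvv'⟩
  have hΓ : c ∈ checkNeighbors H S := Finset.mem_filter.2 ⟨Finset.mem_univ c, h2.le⟩
  refine Finset.mem_filter.2 ⟨hΓ, ?_⟩
  rw [(hS.elementary c hΓ).resolve_left h2.ne']
  exact even_two

theorem IsLETS.exists_reverse (hS : IsLETS H S) (x : StateVar H S) :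
    ∃ y : StateVar H S, y.1.2 = x.1.2 ∧ y.1.1 ≠ x.1.1 := by
  have := hS.checkDegree_eq_two x.2.2.1
  obtain ⟨v, hv, hne⟩ := Finset.exists_mem_ne (this ▸ one_lt_two) x.1.1
  obtain ⟨hvS, hv1⟩ := Finset.mem_filter.1 hv
  exact ⟨⟨(v, x.1.2), hvS, x.2.2.1, hv1⟩, rfl, hne⟩

theorem IsLETS.eq_of_check_eq (hS : IsLETS H S) {x y z : StateVar H S} (hy : y.1.2 = x.1.2)
    (hz : z.1.2 = x.1.2) (hyx : y.1.1 ≠ x.1.1) (hzx : z.1.1 ≠ x.1.1) : y = z := by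
  refine Subtype.ext (Prod.ext ?_ (hy.trans hz.symm))
  by_contra hyz
  have h2 : 2 < checkDegree H S x.1.2 := Finset.two_lt_card.2
    ⟨x.1.1, Finset.mem_filter.2 ⟨x.2.1, x.2.2.2⟩,
      y.1.1, Finset.mem_filter.2 ⟨y.2.1, hy ▸ y.2.2.2⟩,
      z.1.1, Finset.mem_filter.2 ⟨z.2.1, hz ▸ z.2.2.2⟩, hyx.symm, hzx.symm, hyz⟩
  exact h2.ne' (hS.checkDegree_eq_two x.2.2.1)

/-- The state variable at the other end of the same check node. -/
noncomputable def IsLETS.reverse (hS : IsLETS H S) (x : StateVar H S) : StateVar H S :=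
  (hS.exists_reverse x).choose

theorem IsLETS.reverse_check (hS : IsLETS H S) (x : StateVar H S) :
    (hS.reverse x).1.2 = x.1.2 :=
  (hS.exists_reverse x).choose_spec.1

theorem IsLETS.reverse_variable_ne (hS : IsLETS H S) (x : StateVar H S) :
    (hS.reverse x).1.1 ≠ x.1.1 :=
  (hS.exists_reverse x).choose_spec.2

theorem IsLETS.reverse_involutive (hS : IsLETS H S) : Function.Involutive hS.reverse := fun x =>
  hS.eq_of_check_eq (x := hS.reverse x) (hS.reverse_check _) (hS.reverse_check x).symm
    (hS.reverse_variable_ne _) (hS.reverse_variable_ne x).symm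

theorem IsLETS.exists_ne_of_variable (hS : IsLETS H S) (x : StateVar H S) :
    ∃ z, z ≠ x ∧ z.1.1 = x.1.1 := by
  obtain ⟨c, hc, hne⟩ := Finset.exists_mem_ne (hS.leafless x.1.1 x.2.1) x.1.2
  obtain ⟨hcm, hc1⟩ := Finset.mem_filter.1 hc
  exact ⟨⟨(x.1.1, c), x.2.1, hcm, hc1⟩, fun h => hne (congrArg (fun z => z.1.2) h), rfl⟩

/-- Not being a simple cycle, with all missatisfied degrees at least 2, leaves a variable node of
degree at least 3. -/
theorem IsLETS.exists_three (hS : IsLETS H S) (hconn : (inducedSubgraph H S).Connected)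
    (hcycle : ¬ IsSimpleCycle H S) :
    ∃ x y z : StateVar H S, x ≠ y ∧ x ≠ z ∧ y ≠ z ∧ x.1.1 = y.1.1 ∧ x.1.1 = z.1.1 := by
  obtain ⟨v, hv, hne⟩ : ∃ v ∈ S, missatisfiedDegree H S v ≠ 2 := by
    by_contra! h
    exact hcycle ⟨hS, hconn, h⟩
  obtain ⟨c₁, h₁, c₂, h₂, c₃, h₃, h₁₂, h₁₃, h₂₃⟩ :=
    Finset.two_lt_card.1 ((hS.leafless v hv).lt_of_ne hne.symm)
  rw [Finset.mem_filter] at h₁ h₂ h₃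
  exact ⟨⟨(v, c₁), hv, h₁⟩, ⟨(v, c₂), hv, h₂⟩, ⟨(v, c₃), hv, h₃⟩,
    fun h => h₁₂ (congrArg (fun z => z.1.2) h), fun h => h₁₃ (congrArg (fun z => z.1.2) h),
    fun h => h₂₃ (congrArg (fun z => z.1.2) h), rfl, rfl⟩

/-- Check nodes of degree 1 are dead ends, so connectedness of the induced subgraph passes to the
multigraph whose edges are the missatisfied check nodes. -/
theorem IsLETS.variable_induction (hS : IsLETS H S) (hconn : (inducedSubgraph H S).Connected)
    (G : V → Prop) (h₀ : ∃ x : StateVar H S, G x.1.1)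
    (hG : ∀ x : StateVar H S, G x.1.1 → G (hS.reverse x).1.1) (x : StateVar H S) : G x.1.1 := by
  -- A check node counts as good when one of its neighbours in S is; from there a walk either
  -- returns to that neighbour or crosses to its reverse.
  let good : V ⊕ C → Prop := Sum.elim G fun c => ∃ v ∈ S, H c v = 1 ∧ G v
  have mem : ∀ v ∈ S, (Sum.inl v : V ⊕ C) ∈
      (Sum.inl '' (S : Set V) ∪ Sum.inr '' (checkNeighbors H S : Set C) : Set (V ⊕ C)) :=
    fun v hv => .inl ⟨v, hv, rfl⟩
  obtain ⟨x₀, hx₀⟩ := h₀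
  have := (SimpleGraph.reachable_iff_reflTransGen _ _).1
    (hconn.preconnected ⟨_, mem _ x₀.2.1⟩ ⟨_, mem _ x.2.1⟩)
  have key : ∀ q, ReflTransGen (inducedSubgraph H S).Adj ⟨_, mem _ x₀.2.1⟩ q → good q.1 := by
    intro q hq
    induction hq with
    | refl => exact hx₀
    | @tail p q _ hpq ih =>
      obtain ⟨p, hp⟩ := p
      obtain ⟨q, hq⟩ := q
      rcases hpq with ⟨v, c, rfl, rfl, hcv⟩ | ⟨v, c, rfl, rfl, hcv⟩
      · exact ⟨v, by simpa using hp, hcv, ih⟩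
      · obtain ⟨v', hv', hcv', hGv'⟩ := ih
        have hv : v ∈ S := by simpa using hq
        change G v
        rcases eq_or_ne v v' with rfl | hne
        · exact hGv'
        · have hc := mem_missatisfied_of_ne hS hv hv' hne hcv hcv'
          let y : StateVar H S := ⟨(v', c), hv', hc, hcv'⟩
          have : hS.reverse y = ⟨(v, c), hv, hc, hcv⟩ :=
            hS.eq_of_check_eq (x := y) (hS.reverse_check y) rfl (hS.reverse_variable_ne y) hne
          have h := hG y hGv'
          rwa [this] at h
  exact key _ this

variable [DecidableEq C] [DecidableEq V]

/-- The message x uses the message y when arc y ends where arc x starts; the condition c' ≠ c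
forbids going straight back. -/
theorem IsLETS.floodingMatrix_ne_zero_iff (hS : IsLETS H S) (x y : StateVar H S) :
    floodingMatrix H S x y ≠ 0 ↔ Follows hS.reverse (fun x => x.1.1) x y := by
  have hA : floodingMatrix H S x y ≠ 0 ↔
      y.1.2 ≠ x.1.2 ∧ y.1.1 ≠ x.1.1 ∧ H y.1.2 x.1.1 = 1 := by
    rw [floodingMatrix, of_apply, ne_eq, ite_eq_right_iff, Classical.not_imp,
      and_iff_left one_ne_zero]
  rw [hA]
  constructor
  · rintro ⟨hc, hv, h1⟩
    have : hS.reverse y = ⟨(x.1.1, y.1.2), x.2.1, y.2.2.1, h1⟩ :=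
      hS.eq_of_check_eq (x := y) (hS.reverse_check y) rfl (hS.reverse_variable_ne y) hv.symm
    rw [Follows, this]
    exact ⟨rfl, fun h => hc (congrArg (fun z => z.1.2) h).symm⟩
  · rintro ⟨hτ, hne⟩
    refine ⟨fun h => hne ?_, fun h => ?_, ?_⟩
    · exact Subtype.ext (Prod.ext hτ (h.symm.trans (hS.reverse_check y).symm))
    · exact hS.reverse_variable_ne y (h.trans hτ).symm
    · have := (hS.reverse y).2.2.2
      rw [hS.reverse_check] at this
      rw [show x.1.1 = _ from hτ]
      exact this

theorem floodingMatrix_eq_zero_or_one (x y : StateVar H S) :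
    floodingMatrix H S x y = 0 ∨ floodingMatrix H S x y = 1 := by
  rw [floodingMatrix, of_apply]
  split_ifs
  · exact .inr rfl
  · exact .inl rfl

theorem floodingMatrix_nonneg (x y : StateVar H S) : 0 ≤ floodingMatrix H S x y := by
  rcases floodingMatrix_eq_zero_or_one x y with h | h <;> rw [h]
  exact zero_le_one

theorem IsLETS.floodingMatrix_reverse (hS : IsLETS H S) {x z : StateVar H S} (hne : x ≠ z)
    (h : x.1.1 = z.1.1) : floodingMatrix H S x (hS.reverse z) = 1 := by
  refine (floodingMatrix_eq_zero_or_one _ _).resolve_left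
    ((hS.floodingMatrix_ne_zero_iff _ _).2 ⟨?_, ?_⟩) <;> rwa [hS.reverse_involutive]

theorem IsLETS.exists_floodingMatrix_ne_zero (hS : IsLETS H S) (y : StateVar H S) :
    ∃ x, floodingMatrix H S x y ≠ 0 := by
  obtain ⟨z, hne, h⟩ := hS.exists_ne_of_variable (hS.reverse y)
  exact ⟨z, (hS.floodingMatrix_ne_zero_iff _ _).2 ⟨h, hne⟩⟩

variable [Fintype V]

theorem IsLETS.one_le_sum_floodingMatrix (hS : IsLETS H S) (x : StateVar H S) :
    1 ≤ ∑ y, floodingMatrix H S x y := by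
  obtain ⟨z, hne, h⟩ := hS.exists_ne_of_variable x
  rw [← hS.floodingMatrix_reverse hne.symm h.symm]
  exact Finset.single_le_sum (fun y _ => floodingMatrix_nonneg x y) (Finset.mem_univ _)

theorem IsLETS.exists_one_lt_sum_floodingMatrix (hS : IsLETS H S)
    (hconn : (inducedSubgraph H S).Connected) (hcycle : ¬ IsSimpleCycle H S) :
    ∃ x, 1 < ∑ y, floodingMatrix H S x y := by
  obtain ⟨x, y, z, hxy, hxz, hyz, hτy, hτz⟩ := hS.exists_three hconn hcycle
  refine ⟨x, ?_⟩
  calc (1 : ℝ) < 1 + 1 := by norm_num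
    _ = ∑ w ∈ {hS.reverse y, hS.reverse z}, floodingMatrix H S x w := by
      rw [Finset.sum_pair (hS.reverse_involutive.injective.ne hyz),
        hS.floodingMatrix_reverse hxy hτy, hS.floodingMatrix_reverse hxz hτz]
    _ ≤ _ := Finset.sum_le_sum_of_subset_of_nonneg (Finset.subset_univ _)
      fun w _ _ => floodingMatrix_nonneg x w

theorem IsLETS.reflTransGen_floodingMatrix (hS : IsLETS H S)
    (hconn : (inducedSubgraph H S).Connected) (hcycle : ¬ IsSimpleCycle H S)
    (x y : StateVar H S) : ReflTransGen (fun i j => floodingMatrix H S i j ≠ 0) x y :=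
  ReflTransGen.mono (fun i j => (hS.floodingMatrix_ne_zero_iff i j).2) _ _
    (reflTransGen_follows hS.reverse_involutive hS.exists_ne_of_variable
      (hS.exists_three hconn hcycle) (hS.variable_induction hconn) x y)

theorem isSweep_layeredMatrix {mb : ℕ} (layer : C → Fin mb) :
    IsSweep (floodingMatrix H S) (layeredMatrix H layer S) fun x => layer x.1.2 :=
  isSweep_prod_updateLayer (floodingMatrix H S) (fun x : StateVar H S => layer x.1.2)
    (Finset.sortedGT_sort _).pairwise
    fun x => (Finset.mem_sort _).2 (Finset.mem_image_of_mem layer x.2.2.1)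

end StateVariables

end LETS

theorem mainTheorem1 {C V : Type*} [Fintype C] [Fintype V] [DecidableEq C] [DecidableEq V]
    {mb : ℕ} (H : Matrix C V (ZMod 2)) (layer : C → Fin mb) (S : Finset V)
    (hS : LETS.IsLETS H S) (hconn : (LETS.inducedSubgraph H S).Connected)
    (hcycle : ¬ LETS.IsSimpleCycle H S) :
    -- a Frobenius normal form exists; `r` below does not depend on its choice
    (∃ (t : ℕ) (b : LETS.StateVar H S → Fin t),
      LETS.IsFrobeniusNormalForm (LETS.layeredMatrix H layer S) b) ∧
    ∃ r : ℝ,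
      -- `r` is a simple eigenvalue, is larger than one, and equals the spectral radius
      1 < r ∧
      (LETS.layeredMatrix H layer S).charpoly.rootMultiplicity r = 1 ∧
      spectralRadius ℂ ((LETS.layeredMatrix H layer S).map (algebraMap ℝ ℂ)) = ENNReal.ofReal r ∧
      -- every Frobenius normal form
      ∀ (t : ℕ) (b : LETS.StateVar H S → Fin t),
        LETS.IsFrobeniusNormalForm (LETS.layeredMatrix H layer S) b →
        ∃ k : Fin t,
          -- has exactly one irreducible diagonal block
          ((LETS.layeredMatrix H layer S).toSquareBlock b k).IsIrreducible ∧
          (∀ k', ((LETS.layeredMatrix H layer S).toSquareBlock b k').IsIrreducible → k' = k) ∧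
          -- which comes last, and the other `n_z` rows and columns give the array `[0 Ã'; 0 Ã]`
          (∀ k', k' ≤ k) ∧
          Nat.card {x // b x ≠ k} = LETS.nz H layer S ∧
          (LETS.layeredMatrix H layer S).toBlock (fun x => b x ≠ k) (fun x => b x ≠ k) = 0 ∧
          (LETS.layeredMatrix H layer S).toBlock (fun x => b x = k) (fun x => b x ≠ k) = 0 ∧
          -- the left eigenvector for `r`: a positive left eigenvector of `Ã` padded with zeros,
          -- unique up to scaling
          (∃ ω : {x // b x = k} → ℝ, (∀ x, 0 < ω x) ∧
            Matrix.vecMul ω ((LETS.layeredMatrix H layer S).toSquareBlock b k) = r • ω ∧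
            (∀ x, 0 ≤ LETS.stack b k 0 ω x) ∧
            Matrix.vecMul (LETS.stack b k 0 ω) (LETS.layeredMatrix H layer S) =
              r • LETS.stack b k 0 ω ∧
            ∀ w : LETS.StateVar H S → ℝ,
              Matrix.vecMul w (LETS.layeredMatrix H layer S) = r • w →
              ∃ s : ℝ, w = s • LETS.stack b k 0 ω) ∧
          -- the right eigenvector for `r`: a positive right eigenvector `ν` of `Ã` stacked with
          -- `(Ã' / r) ν`, unique up to scaling
          (∃ ν : {x // b x = k} → ℝ, (∀ x, 0 < ν x) ∧
            Matrix.mulVec ((LETS.layeredMatrix H layer S).toSquareBlock b k) ν = r • ν ∧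
            (∀ x, 0 ≤ LETS.stack b k (r⁻¹ • Matrix.mulVec ((LETS.layeredMatrix H layer S).toBlock
                  (fun x => b x ≠ k) (fun x => b x = k)) ν) ν x) ∧
            Matrix.mulVec (LETS.layeredMatrix H layer S)
                (LETS.stack b k (r⁻¹ • Matrix.mulVec ((LETS.layeredMatrix H layer S).toBlock
                  (fun x => b x ≠ k) (fun x => b x = k)) ν) ν) =
              r • LETS.stack b k (r⁻¹ • Matrix.mulVec ((LETS.layeredMatrix H layer S).toBlock
                  (fun x => b x ≠ k) (fun x => b x = k)) ν) ν ∧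
            ∀ u : LETS.StateVar H S → ℝ,
              Matrix.mulVec (LETS.layeredMatrix H layer S) u = r • u →
              ∃ s : ℝ, u = s • LETS.stack b k (r⁻¹ • Matrix.mulVec
                ((LETS.layeredMatrix H layer S).toBlock
                  (fun x => b x ≠ k) (fun x => b x = k)) ν) ν) := by
  have hM := LETS.isSweep_layeredMatrix (H := H) (S := S) layer
  set M := LETS.layeredMatrix H layer S
  -- The complement of the set counted by `nz`, and the index set of the irreducible block in every
  -- normal form.
  let p : LETS.StateVar H S → Prop := fun x =>
    ∃ z, LETS.floodingMatrix H S z x ≠ 0 ∧ ¬ layer x.1.2 < layer z.1.2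
  have hA := LETS.floodingMatrix_nonneg (H := H) (S := S)
  have hM0 := hM.apply_nonneg hA
  have hrow := hS.one_le_sum_floodingMatrix
  have hcol : ∀ x y, ¬ p y → M x y = 0 := fun x y hy =>
    hM.apply_eq_zero (fun z hz => by
      by_contra h
      exact hy ⟨z, hz, h⟩) x
  have hreach : ∀ x y, p y → Relation.TransGen (fun i j => 0 < M i j) x y := fun x y hy => by
    obtain ⟨z, hzy, hle⟩ := hy
    exact hM.transGen_of_reflTransGen hA (hS.reflTransGen_floodingMatrix hconn hcycle x z) hzy hle
  obtain ⟨x₀, hx₀, hx₀'⟩ := hM.exists_one_lt_rowSum hA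
    (fun x y h => ((LETS.floodingMatrix_eq_zero_or_one x y).resolve_left h).ge) hrow
    (hS.exists_one_lt_sum_floodingMatrix hconn hcycle) hS.exists_floodingMatrix_ne_zero
  have hfnf := LETS.exists_isFrobeniusNormalForm hM0 hcol hreach ⟨x₀, hx₀⟩
  refine ⟨hfnf, ?_⟩
  have perron : ∀ {t : ℕ} {b : LETS.StateVar H S → Fin t} {k : Fin t}, (∀ x, b x = k ↔ p x) →
      (M.toSquareBlock b k).IsIrreducible → _ := fun {t b k} hk hirr =>
    LETS.exists_perron_of_irreducible_block hM0 (b := b) (k := k)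
      (fun x y hy => hcol x y fun h => hy ((hk y).2 h)) hirr (hM.one_le_rowSum hA hrow)
      ⟨x₀, (hk x₀).2 hx₀, hx₀'⟩
  obtain ⟨t₀, b₀, hb₀⟩ := hfnf
  obtain ⟨k₀, hk₀, hirr₀, -⟩ := hb₀.exists_block hcol hreach ⟨x₀, hx₀⟩
  obtain ⟨r, hr, hmult, hrad, -⟩ := perron hk₀ hirr₀
  refine ⟨r, hr, hmult, hrad, fun t b hb => ?_⟩
  obtain ⟨k, hk, hirr, huniq, hlast⟩ := hb.exists_block hcol hreach ⟨x₀, hx₀⟩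
  obtain ⟨r', hr', -, hrad', hleft, hright⟩ := perron hk hirr
  -- Both roots are the spectral radius, so the eigenvalue does not depend on the normal form.
  obtain rfl : r = r' :=
    (ENNReal.ofReal_eq_ofReal_iff (by positivity) (by positivity)).1 (hrad.symm.trans hrad')
  have hcol' : ∀ x y, b y ≠ k → M x y = 0 := fun x y hy =>
    hcol x y fun h => hy ((hk y).2 h)
  refine ⟨k, hirr, huniq, hlast, ?_, ?_, ?_, hleft, hright⟩
  · rw [Nat.card_eq_fintype_card, Fintype.card_subtype, LETS.nz]
    congr 1
    ext x
    simp [hk, p]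
  · ext x y
    exact hcol' x y y.2
  · ext x y
    exact hcol' x y y.2
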